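/- Let $R$ be a commutative noetherian local ring with maximal ideal $\mathfrak m$ and residue field $k=R/\mathfrak m$, such that $\mathfrak m^3=0\neq\mathfrak m^2$, and assume that $R$ is not Gorenstein (that is, $R$ has infinite injective dimension as a module over itself). All modules are finitely generated, $\operatorname{Soc}R=(0:\mathfrak m)$, and $M_i$ denotes the $i$th syzygy of a module $M$ in its minimal free resolution ($M_0=M$, and $M_{i+1}$ is the kernel of a surjection $R^n\to M_i$ whose kernel lies in $\mathfrak m R^n$). A syzygy module is a module isomorphic to $L_i$ for some module $L$ and some $i\ge 1$. If there is a syzygy module $N\neq 0$ with $\operatorname{Ext}^h_R(N,R)=0$ for some $h\ge 2$, then $\operatorname{Soc}R=\mathfrak m^2$. Moreover, let $M\neq 0$ be a module with $\mathfrak m^2M=0$. For $h\ge 1$ the module $M$ is called $h$-exceptional if $k$ is not (isomorphic to) a direct summand of $M_i$ for any $1\le i\le h$, and exceptional if it is $h$-exceptional for every $h\ge 1$; these terms are used only when $\operatorname{Soc}R=\mathfrak m^2$. Then the following hold. (a) If $\operatorname{Ext}^2_R(M,R)=0$ and $M$ is a syzygy module, then $\operatorname{Soc}R=\mathfrak m^2$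 and $M$ is $1$-exceptional. (b) If $\operatorname{Ext}^{h+1}_R(M,R)=0$ for some $h\ge 2$, then $\operatorname{Soc}R=\mathfrak m^2$ and $M$ is $h$-exceptional for that $h$. (c) If $\operatorname{Ext}^h_R(M,R)=0$ for infinitely many $h\ge 1$, then $\operatorname{Soc}R=\mathfrak m^2$ and $M$ is exceptional. -/

import Mathlib

open CategoryTheory IsLocalRing

universe u

/-- A local ring (taken to be commutative noetherian wherever this is used) is Gorenstein
if it has finite injective dimension as a module over itself. -/
def IsGorensteinLocal (R : Type u) [CommRing R] [IsLocalRing R] : Prop :=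
  ∃ n : ℕ, HasInjectiveDimensionLE (ModuleCat.of R R) n

/-- The socle `(0 : 𝔪)` of a local ring. -/
def localSocle (R : Type*) [CommRing R] [IsLocalRing R] : Ideal R :=
  (maximalIdeal R).annihilator

/-- `f : Rⁿ → M` is a minimal free cover: it is surjective and its kernel lies in `𝔪 Rⁿ`. -/
def IsMinimalFreeCover {R : Type*} [CommRing R] [IsLocalRing R] {M : Type*} [AddCommGroup M]
    [Module R M] {n : ℕ} (f : (Fin n → R) →ₗ[R] M) : Prop :=
  Function.Surjective f ∧ ∀ x ∈ LinearMap.ker f, ∀ i, x i ∈ maximalIdeal R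

/-- `N` is (isomorphic to) the first syzygy of `M`, the kernel of a minimal free cover. -/
def IsFirstSyzygyOf (R : Type*) [CommRing R] [IsLocalRing R] (N M : Type*) [AddCommGroup N]
    [Module R N] [AddCommGroup M] [Module R M] : Prop :=
  ∃ (n : ℕ) (f : (Fin n → R) →ₗ[R] M),
    IsMinimalFreeCover f ∧ Nonempty (N ≃ₗ[R] LinearMap.ker f)

open scoped TensorProduct in
/-- Every finitely generated module over a local ring has a minimal free cover. -/
theorem exists_isMinimalFreeCover (R : Type*) [CommRing R] [IsLocalRing R] (M : Type*)
    [AddCommGroup M] [Module R M] [Module.Finite R M] :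
    ∃ (n : ℕ) (f : (Fin n → R) →ₗ[R] M), IsMinimalFreeCover f := by
  let b := Module.finBasis (ResidueField R) (ResidueField R ⊗[R] M)
  have hs : Function.Surjective (TensorProduct.mk R (ResidueField R) M 1) :=
    TensorProduct.mk_surjective R M (ResidueField R) Ideal.Quotient.mk_surjective
  choose v hv using fun i => hs (b i)
  let f := Fintype.linearCombination R v
  refine ⟨_, f, ?_, fun x hx i => ?_⟩
  · rw [← LinearMap.range_eq_top, Fintype.range_linearCombination]
    exact span_eq_top_of_tmul_eq_basis v b hv
  · have h0 : TensorProduct.mk R (ResidueField R) M 1 (f x) = 0 := by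
      rw [LinearMap.mem_ker.mp hx, map_zero]
    rw [Fintype.linearCombination_apply, map_sum] at h0
    simp only [map_smul, hv] at h0
    have h1 : ∑ j, residue R (x j) • b j = 0 := by
      rw [← h0]
      exact Finset.sum_congr rfl fun j _ => algebraMap_smul (ResidueField R) (x j) (b j)
    exact (residue_eq_zero_iff _).mp (Fintype.linearIndependent_iff.mp b.linearIndependent _ h1 i)

/-- Every finitely generated module over a noetherian local ring has a first syzygy, and it is
again finitely generated. -/
theorem exists_isFirstSyzygyOf {R : Type u} [CommRing R] [IsLocalRing R] [IsNoetherianRing R]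
    (M : ModuleCat.{u} R) [Module.Finite R M] :
    ∃ N : ModuleCat.{u} R, Module.Finite R N ∧ IsFirstSyzygyOf R N M := by
  obtain ⟨n, f, hf⟩ := exists_isMinimalFreeCover R M
  have : Module.Finite R (LinearMap.ker f) := inferInstance
  exact ⟨ModuleCat.of R (LinearMap.ker f), this, n, f, hf, ⟨LinearEquiv.refl R _⟩⟩

/-- `IsSyzygyOf i N M` says that `N` is (isomorphic to) the `i`-th syzygy of `M`
in a minimal free resolution of `M`. -/
def IsSyzygyOf {R : Type u} [CommRing R] [IsLocalRing R] :
    ℕ → ModuleCat.{u} R → ModuleCat.{u} R → Prop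
  | 0, N, M => Nonempty (N ≃ₗ[R] M)
  | i + 1, N, M => ∃ L : ModuleCat.{u} R, IsSyzygyOf i L M ∧ IsFirstSyzygyOf R N L

/-- `N` is a syzygy module: an `i`-th syzygy, for some `i ≥ 1`, of some finitely generated
module. -/
def IsSyzygyModule {R : Type u} [CommRing R] [IsLocalRing R] (N : ModuleCat.{u} R) : Prop :=
  ∃ L : ModuleCat.{u} R, Module.Finite R L ∧ ∃ i : ℕ, 1 ≤ i ∧ IsSyzygyOf i N L

/-- `K` is (isomorphic to) a direct summand of `N`. -/
def IsDirectSummandOf (R : Type*) [CommRing R] (K N : Type*) [AddCommGroup K] [Module R K]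
    [AddCommGroup N] [Module R N] : Prop :=
  ∃ P Q : Submodule R N, IsCompl P Q ∧ Nonempty (K ≃ₗ[R] P)

/-- `M` is `h`-exceptional: the residue field is not a direct summand of the `i`-th syzygy of
`M` for `1 ≤ i ≤ h`. (The notion is used for non-zero modules `M` with `𝔪² M = 0` over rings
whose socle is `𝔪²`.) -/
def IsHExceptional {R : Type u} [CommRing R] [IsLocalRing R] (h : ℕ) (M : ModuleCat.{u} R) : Prop :=
  ∀ i : ℕ, 1 ≤ i → i ≤ h → ∀ N : ModuleCat.{u} R, IsSyzygyOf i N M →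
    ¬ IsDirectSummandOf R (ResidueField R) N

/-- `M` is exceptional: it is `h`-exceptional for every `h ≥ 1`. -/
def IsExceptional {R : Type u} [CommRing R] [IsLocalRing R] (M : ModuleCat.{u} R) : Prop :=
  ∀ h : ℕ, 1 ≤ h → IsHExceptional h M

/-- `Ext^h_R(M, R) = 0`. -/
def ExtToRingVanishes {R : Type u} [CommRing R] (h : ℕ) (M : ModuleCat.{u} R) : Prop :=
  Subsingleton (Abelian.Ext M (ModuleCat.of R R) h)

/-! Since 𝔪 is nilpotent, every finitely generated module is an iterated extension of copies of k.
One vanishing Ext^n(k, R) with n ≥ 1 thus kills Ext^n(-, R) on all of them and bounds the injective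
dimension of R. As R is not Gorenstein, no such Ext vanishes. Dimension shifting turns Ext^{h+1}(M,
R) = 0 into Ext^{h+1-i}(M_i, R) = 0, so k is not a summand of M_i for 1 ≤ i ≤ h. For the socle, 𝔪³ =
0 gives 𝔪² ⊆ Soc R. A socle element outside 𝔪² would kill any syzygy module N and split k off the
first syzygy of N (`IsFirstSyzygyOf.extToRingVanishes_residueField`), which is again impossible. -/

open Abelian

/-- Vanishing of `Ext` in a fixed positive degree on all finitely generated modules bounds the
injective dimension. -/
theorem hasInjectiveDimensionLE_of_forall_finite {R : Type u} [CommRing R] (n : ℕ)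
    (X : ModuleCat.{u} R)
    (h : ∀ Y : ModuleCat.{u} R, Module.Finite R Y → Subsingleton (Ext Y X (n + 1))) :
    HasInjectiveDimensionLE X n := by
  induction n generalizing X with
  | zero =>
    simp only [HasInjectiveDimensionLE, zero_add, ← injective_iff_hasInjectiveDimensionLT_one]
    -- Baer's criterion tests only the finitely generated modules R/I.
    rw [← Module.injective_iff_injective_object, ← Module.Baer.iff_injective]
    intro I g
    let S : ShortComplex (ModuleCat.{u} R) := ModuleCat.shortComplexOfCompEqZero
      I.subtype I.mkQ (LinearMap.exact_subtype_mkQ I).linearMap_comp_eq_zero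
    have hS : S.ShortExact := ModuleCat.shortComplex_shortExact S
      (LinearMap.exact_subtype_mkQ I) I.subtype_injective I.mkQ_surjective
    have : Subsingleton (Ext S.X₃ X 1) :=
      h (ModuleCat.of R (R ⧸ I)) (inferInstanceAs (Module.Finite R (R ⧸ I)))
    obtain ⟨x₂, hx₂⟩ := Ext.contravariant_sequence_exact₁ hS X
      (Ext.mk₀ (ModuleCat.ofHom g : S.X₁ ⟶ X)) (add_zero 1) (Subsingleton.elim _ _)
    obtain ⟨f, rfl⟩ := (Ext.mk₀_bijective _ _).2 x₂
    rw [Ext.mk₀_comp_mk₀, (Ext.mk₀_bijective _ _).1.eq_iff] at hx₂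
    exact ⟨f.hom, fun x hx => congr($hx₂ (⟨x, hx⟩ : I))⟩
  | succ n ih =>
    obtain ⟨I, _, f, _⟩ := EnoughInjectives.presentation X
    let S := ShortComplex.mk f (Limits.cokernel.π f) (Limits.cokernel.condition f)
    have hS : S.ShortExact := { exact := ShortComplex.exact_cokernel f }
    have hI : Injective S.X₂ := ‹_›
    -- With an injective middle term, Ext^{n+1}(Y, X₃) embeds in Ext^{n+2}(Y, X).
    refine (hS.hasInjectiveDimensionLT_X₃_iff n hI).mp (ih S.X₃ fun Y hY => ?_)
    have : Subsingleton (Ext Y S.X₁ (n + 1 + 1)) := h Y hY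
    refine subsingleton_of_forall_eq 0 fun x => ?_
    obtain ⟨y, rfl⟩ := Ext.covariant_sequence_exact₃ Y hS x rfl (Subsingleton.elim _ _)
    rw [Ext.eq_zero_of_injective y, Ext.zero_comp]

/-- A linear retract induces an injection on `Ext`, so vanishing passes to retracts. -/
theorem subsingleton_ext_of_leftInverse {R : Type u} [CommRing R] {K N X : ModuleCat.{u} R}
    {n : ℕ} (i : K →ₗ[R] N) (r : N →ₗ[R] K) (hri : Function.LeftInverse r i)
    [Subsingleton (Ext N X n)] : Subsingleton (Ext K X n) := by
  refine subsingleton_of_forall_eq 0 fun x => ?_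
  have hid : ModuleCat.ofHom i ≫ ModuleCat.ofHom r = 𝟙 K := by
    ext y
    exact hri y
  rw [← x.mk₀_id_comp, ← hid, ← Ext.mk₀_comp_mk₀, Ext.comp_assoc_of_second_deg_zero,
    Subsingleton.elim ((Ext.mk₀ (ModuleCat.ofHom r)).comp x (zero_add n)) 0, Ext.comp_zero]

/-- Over a noetherian local ring with nilpotent maximal ideal, vanishing of `Ext` on the residue
field implies vanishing on all finitely generated modules. -/
theorem subsingleton_ext_of_residueField {R : Type u} [CommRing R] [IsLocalRing R]
    [IsNoetherianRing R] {e : ℕ} (hm : maximalIdeal R ^ e = ⊥) (X : ModuleCat.{u} R) (n : ℕ)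
    (hk : Subsingleton (Ext (ModuleCat.of R (ResidueField R)) X n))
    (Y : ModuleCat.{u} R) (hY : Module.Finite R Y) : Subsingleton (Ext Y X n) := by
  suffices ∀ (N : Type u) [AddCommGroup N] [Module R N] [Module.Finite R N],
      Subsingleton (Ext (ModuleCat.of R N) X n) from this Y
  intro N _ _ hN
  induction hN using IsNoetherianRing.induction_on_isQuotientEquivQuotientPrime R with
  | subsingleton N =>
    refine subsingleton_of_forall_eq 0 fun x => ?_
    have h0 : 𝟙 (ModuleCat.of R N) = 0 := by
      ext y
      exact Subsingleton.elim (α := N) _ _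
    rw [← x.mk₀_id_comp, h0, Ext.mk₀_zero, Ext.zero_comp]
  | quotient N p f =>
    -- A prime contains the nilpotent ideal 𝔪, so every quotient R/p in a prime filtration is k.
    have hp : p.1 = maximalIdeal R :=
      le_antisymm (le_maximalIdeal p.2.ne_top)
        (p.2.le_of_pow_le (n := e) (hm.trans_le bot_le))
    let g : N ≃ₗ[R] ResidueField R := f.trans (Submodule.quotEquivOfEq _ _ hp)
    exact subsingleton_ext_of_leftInverse (K := ModuleCat.of R N)
      (N := ModuleCat.of R (ResidueField R)) g.toLinearMap g.symm.toLinearMap g.symm_apply_apply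
  | exact N₁ N₂ N₃ f g hf hg hfg h₁ h₃ =>
    let S : ShortComplex (ModuleCat.{u} R) :=
      ModuleCat.shortComplexOfCompEqZero f g hfg.linearMap_comp_eq_zero
    have hS : S.ShortExact := ModuleCat.shortComplex_shortExact S hfg hf hg
    have : Subsingleton (Ext S.X₁ X n) := h₁
    have : Subsingleton (Ext S.X₃ X n) := h₃
    refine subsingleton_of_forall_eq 0 fun (x : Ext S.X₂ X n) => ?_
    obtain ⟨y, rfl⟩ := Ext.contravariant_sequence_exact₂ hS X x (Subsingleton.elim _ _)
    rw [Subsingleton.elim y 0, Ext.comp_zero]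

/-- If a positive `Ext` from the residue field to an artinian local ring vanishes, the ring is
Gorenstein. -/
theorem isGorensteinLocal_of_extToRingVanishes_residueField {R : Type u} [CommRing R]
    [IsLocalRing R] [IsNoetherianRing R] {e : ℕ} (hm : maximalIdeal R ^ e = ⊥) (n : ℕ)
    (hk : ExtToRingVanishes (n + 1) (ModuleCat.of R (ResidueField R))) : IsGorensteinLocal R :=
  ⟨n, hasInjectiveDimensionLE_of_forall_finite n _
    (subsingleton_ext_of_residueField hm _ _ hk)⟩

/-- Dimension shifting along a first syzygy. -/
theorem ExtToRingVanishes.of_isFirstSyzygyOf {R : Type u} [CommRing R] [IsLocalRing R]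
    {M N : ModuleCat.{u} R} {n : ℕ} (h : ExtToRingVanishes (n + 2) M)
    (hN : IsFirstSyzygyOf R N M) : ExtToRingVanishes (n + 1) N := by
  obtain ⟨m, f, ⟨hf, -⟩, ⟨g⟩⟩ := hN
  have hS := LinearMap.shortExact_shortComplexKer hf
  set S := f.shortComplexKer
  have : Module.Free R S.X₂ := inferInstanceAs (Module.Free R (Fin m → R))
  have : Projective S.X₂ := ModuleCat.projective_of_free (Pi.basisFun R (Fin m))
  have : Subsingleton (Ext S.X₃ (ModuleCat.of R R) (n + 2)) := h
  have : Subsingleton (Ext S.X₁ (ModuleCat.of R R) (n + 1)) := by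
    refine subsingleton_of_forall_eq 0 fun x => ?_
    obtain ⟨y, rfl⟩ := Ext.contravariant_sequence_exact₁ hS _ x
      (show 1 + (n + 1) = n + 2 by omega) (Subsingleton.elim _ _)
    rw [Ext.eq_zero_of_projective y, Ext.comp_zero]
  exact subsingleton_ext_of_leftInverse (N := S.X₁) g.toLinearMap g.symm.toLinearMap
    g.symm_apply_apply

theorem ExtToRingVanishes.of_isSyzygyOf {R : Type u} [CommRing R] [IsLocalRing R] {i n : ℕ}
    {M N : ModuleCat.{u} R} (h : ExtToRingVanishes (n + 1 + i) M) (hN : IsSyzygyOf i N M) :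
    ExtToRingVanishes (n + 1) N := by
  induction i generalizing n N with
  | zero =>
    obtain ⟨g⟩ := hN
    have : Subsingleton (Ext M (ModuleCat.of R R) (n + 1)) := h
    exact subsingleton_ext_of_leftInverse g.toLinearMap g.symm.toLinearMap g.symm_apply_apply
  | succ i ih =>
    obtain ⟨L, hL, hNL⟩ := hN
    exact (ih (n := n + 1) (by convert h using 1; omega) hL).of_isFirstSyzygyOf hNL

theorem IsDirectSummandOf.extToRingVanishes {R : Type u} [CommRing R] {K N : ModuleCat.{u} R}
    {n : ℕ} (hKN : IsDirectSummandOf R K N) (h : ExtToRingVanishes n N) :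
    ExtToRingVanishes n K := by
  obtain ⟨P, Q, hPQ, ⟨g⟩⟩ := hKN
  have : Subsingleton (Ext N (ModuleCat.of R R) n) := h
  refine subsingleton_ext_of_leftInverse (P.subtype ∘ₗ g.toLinearMap)
    (g.symm.toLinearMap ∘ₗ P.projectionOnto Q hPQ) fun x => ?_
  simp

/-- If `Ext^{h+1}(M, R) = 0` over a non-Gorenstein artinian local ring, then `M` is
`h`-exceptional. -/
theorem ExtToRingVanishes.isHExceptional {R : Type u} [CommRing R] [IsLocalRing R]
    [IsNoetherianRing R] {e : ℕ} (hm : maximalIdeal R ^ e = ⊥) (hR : ¬ IsGorensteinLocal R)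
    {M : ModuleCat.{u} R} {h : ℕ} (hM : ExtToRingVanishes (h + 1) M) : IsHExceptional h M := by
  intro i _ hih N hN hk
  -- The subtraction is genuine because i ≤ h, and the degree stays positive.
  have hN' : ExtToRingVanishes (h - i + 1) N :=
    ExtToRingVanishes.of_isSyzygyOf (by convert hM using 1; omega) hN
  exact hR (isGorensteinLocal_of_extToRingVanishes_residueField hm (h - i)
    (IsDirectSummandOf.extToRingVanishes (K := ModuleCat.of R (ResidueField R)) hk hN'))

theorem IsHExceptional.mono {R : Type u} [CommRing R] [IsLocalRing R] {M : ModuleCat.{u} R}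
    {h h' : ℕ} (hM : IsHExceptional h' M) (hh : h ≤ h') : IsHExceptional h M :=
  fun i h1 hi => hM i h1 (hi.trans hh)

/-- A socle element outside `𝔪 K` spans a direct summand isomorphic to the residue field. -/
theorem exists_leftInverse_of_notMem_smul_top {R : Type*} [CommRing R] [IsLocalRing R]
    {K : Type*} [AddCommGroup K] [Module R K] (y : K) (hy : ∀ r ∈ maximalIdeal R, r • y = 0)
    (hyK : y ∉ maximalIdeal R • (⊤ : Submodule R K)) :
    ∃ (i : ResidueField R →ₗ[R] K) (r : K →ₗ[R] ResidueField R), Function.LeftInverse r i := by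
  let i : ResidueField R →ₗ[R] K :=
    (maximalIdeal R).liftQ (LinearMap.toSpanSingleton R K y) fun r hr => hy r hr
  let : Field (R ⧸ maximalIdeal R) := Ideal.Quotient.field _
  have hv : (Submodule.Quotient.mk y : K ⧸ maximalIdeal R • (⊤ : Submodule R K)) ≠ 0 :=
    fun h0 => hyK ((Submodule.Quotient.mk_eq_zero _).mp h0)
  -- A functional on the k-vector space K/𝔪K taking the value 1 at the class of y gives the
  -- retraction.
  obtain ⟨φ, hφ⟩ := Module.Projective.exists_dual_eq_one (R ⧸ maximalIdeal R) hv
  refine ⟨i, φ.restrictScalars R ∘ₗ Submodule.mkQ _, fun x => ?_⟩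
  obtain ⟨a, rfl⟩ := Ideal.Quotient.mk_surjective x
  calc φ (Submodule.Quotient.mk (a • y))
      = Ideal.Quotient.mk (maximalIdeal R) a • φ (Submodule.Quotient.mk y) :=
        φ.map_smul (Ideal.Quotient.mk (maximalIdeal R) a) (Submodule.Quotient.mk y)
    _ = Ideal.Quotient.mk (maximalIdeal R) a := by rw [hφ, smul_eq_mul, mul_one]

/-- A first syzygy of a nonzero module killed by a socle element `x ∉ 𝔪²` has the residue field
as a retract. -/
theorem IsFirstSyzygyOf.extToRingVanishes_residueField {R : Type u} [CommRing R] [IsLocalRing R]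
    {x : R} (hx : x ∈ localSocle R) (hx2 : x ∉ maximalIdeal R ^ 2) {N K : ModuleCat.{u} R}
    [Nontrivial N] (hxN : ∀ y : N, x • y = 0) (hK : IsFirstSyzygyOf R K N) {n : ℕ}
    (h : ExtToRingVanishes n K) :
    ExtToRingVanishes n (ModuleCat.of R (ResidueField R)) := by
  obtain ⟨m, f, ⟨hf, hmin⟩, ⟨g⟩⟩ := hK
  have : Nonempty (Fin m) := by
    by_contra hm
    rw [not_nonempty_iff] at hm
    exact not_subsingleton N hf.subsingleton
  obtain ⟨j⟩ := this
  -- The element x e_j lies in the kernel because x kills N.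
  let y : LinearMap.ker f := ⟨x • Pi.single j 1, by simp [hxN]⟩
  have hK : Subsingleton (Ext K (ModuleCat.of R R) n) := h
  obtain ⟨i, r, hri⟩ := exists_leftInverse_of_notMem_smul_top (K := LinearMap.ker f) y
    (fun r hr => Subtype.ext (by
      have : r * x = 0 := by
        rw [mul_comm]; exact Submodule.mem_annihilator.mp hx r hr
      simp [y, smul_smul, this]))
    -- By minimality ker f ⊆ 𝔪Rᵐ, so elements of 𝔪 ker f have coordinates in 𝔪², whereas y has j-th
    -- coordinate x.
    (fun hy => hx2 (by
      have key : ∀ z ∈ maximalIdeal R • (⊤ : Submodule R (LinearMap.ker f)),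
          z.1 j ∈ maximalIdeal R ^ 2 := by
        intro z hz
        refine Submodule.smul_induction_on hz (fun r hr z _ => ?_) fun z w hz hw => ?_
        · rw [pow_two]
          exact Ideal.mul_mem_mul hr (hmin _ z.2 j)
        · exact add_mem hz hw
      simpa [y] using key y hy))
  exact subsingleton_ext_of_leftInverse (K := ModuleCat.of R (ResidueField R))
    (g.symm.toLinearMap ∘ₗ i) (r ∘ₗ g.toLinearMap) fun x => by simpa using hri x

/-- A syzygy module is killed by the socle. -/
theorem IsSyzygyModule.smul_eq_zero {R : Type u} [CommRing R] [IsLocalRing R]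
    {N : ModuleCat.{u} R} (hN : IsSyzygyModule N) {x : R} (hx : x ∈ localSocle R) (y : N) :
    x • y = 0 := by
  obtain ⟨L, -, i, hi, hNL⟩ := hN
  obtain ⟨i, rfl⟩ := Nat.exists_eq_add_of_le' hi
  obtain ⟨L', -, n, f, ⟨-, hmin⟩, ⟨g⟩⟩ := hNL
  apply g.injective
  ext j
  simpa using Submodule.mem_annihilator.mp hx _ (hmin _ (g y).2 j)

/-- The bound h ≥ 2 leaves a positive degree after shifting to the first syzygy of N. -/
theorem IsSyzygyModule.localSocle_eq {R : Type u} [CommRing R] [IsLocalRing R]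
    [IsNoetherianRing R] (hm3 : maximalIdeal R ^ 3 = ⊥) (hR : ¬ IsGorensteinLocal R)
    {N : ModuleCat.{u} R} [Module.Finite R N] [Nontrivial N] (hN : IsSyzygyModule N) {h : ℕ}
    (hh : 2 ≤ h) (hE : ExtToRingVanishes h N) : localSocle R = maximalIdeal R ^ 2 := by
  refine le_antisymm (fun x hx => ?_) fun x hx => ?_
  · by_contra hx2
    obtain ⟨K, -, hK⟩ := exists_isFirstSyzygyOf N
    obtain ⟨n, rfl⟩ := Nat.exists_eq_add_of_le' hh
    exact hR (isGorensteinLocal_of_extToRingVanishes_residueField hm3 n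
      (hK.extToRingVanishes_residueField hx hx2 (hN.smul_eq_zero hx) (hE.of_isFirstSyzygyOf hK)))
  · refine Submodule.mem_annihilator.mpr fun r hr => ?_
    have : x * r ∈ maximalIdeal R ^ 3 := by
      rw [pow_succ]
      exact Ideal.mul_mem_mul hx hr
    rwa [hm3, Ideal.mem_bot] at this

/-- A nonzero module killed by a nonzero ideal is not free, so its first syzygy is nonzero. -/
theorem IsFirstSyzygyOf.nontrivial {R : Type*} [CommRing R] [IsLocalRing R] {I : Ideal R}
    (hI : I ≠ ⊥) {N M : Type*} [AddCommGroup N] [Module R N] [AddCommGroup M] [Module R M]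
    [Nontrivial M] (hM : I • (⊤ : Submodule R M) = ⊥) (h : IsFirstSyzygyOf R N M) :
    Nontrivial N := by
  obtain ⟨n, f, ⟨hf, -⟩, ⟨g⟩⟩ := h
  have : Nonempty (Fin n) := by
    by_contra hn
    rw [not_nonempty_iff] at hn
    exact not_subsingleton M hf.subsingleton
  obtain ⟨j⟩ := this
  obtain ⟨x, hx, hx0⟩ := Submodule.exists_mem_ne_zero_of_ne_bot hI
  have hxj : x • Pi.single j 1 ∈ LinearMap.ker f := by
    rw [LinearMap.mem_ker, map_smul, ← Submodule.mem_bot R, ← hM]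
    exact Submodule.smul_mem_smul hx trivial
  have : Nontrivial (LinearMap.ker f) := by
    refine ⟨⟨x • Pi.single j 1, hxj⟩, 0, fun h0 => hx0 ?_⟩
    simpa using congr_fun (congrArg Subtype.val h0) j
  exact g.toEquiv.nontrivial

/-- M need not be a syzygy module, so its first syzygy, nonzero because 𝔪² ≠ 0 kills M, takes its
place at the cost of one degree. -/
theorem localSocle_eq_of_extToRingVanishes {R : Type u} [CommRing R] [IsLocalRing R]
    [IsNoetherianRing R] (hm3 : maximalIdeal R ^ 3 = ⊥) (hm2 : maximalIdeal R ^ 2 ≠ ⊥)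
    (hR : ¬ IsGorensteinLocal R) {M : ModuleCat.{u} R} [Module.Finite R M] [Nontrivial M]
    (hM : (maximalIdeal R ^ 2) • (⊤ : Submodule R M) = ⊥) {h : ℕ} (hh : 2 ≤ h)
    (hE : ExtToRingVanishes (h + 1) M) : localSocle R = maximalIdeal R ^ 2 := by
  obtain ⟨K, _, hK⟩ := exists_isFirstSyzygyOf M
  have := hK.nontrivial hm2 hM
  have hKs : IsSyzygyModule K := ⟨M, inferInstance, 1, le_rfl, M, ⟨LinearEquiv.refl R M⟩, hK⟩
  obtain ⟨n, rfl⟩ := Nat.exists_eq_add_of_le' hh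
  exact hKs.localSocle_eq hm3 hR hh (hE.of_isFirstSyzygyOf hK)

theorem mainTheorem5 {R : Type u} [CommRing R] [IsLocalRing R] [IsNoetherianRing R]
    (hm3 : maximalIdeal R ^ 3 = ⊥) (hm2 : maximalIdeal R ^ 2 ≠ ⊥)
    (hR : ¬ IsGorensteinLocal R) :
    (∀ N : ModuleCat.{u} R, Module.Finite R N → Nontrivial N → IsSyzygyModule N →
      (∃ h : ℕ, 2 ≤ h ∧ ExtToRingVanishes h N) →
        localSocle R = maximalIdeal R ^ 2) ∧
    (∀ M : ModuleCat.{u} R, Module.Finite R M → Nontrivial M →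
      (maximalIdeal R ^ 2) • (⊤ : Submodule R M) = ⊥ →
        (ExtToRingVanishes 2 M → IsSyzygyModule M →
          localSocle R = maximalIdeal R ^ 2 ∧ IsHExceptional 1 M) ∧
        (∀ h : ℕ, 2 ≤ h → ExtToRingVanishes (h + 1) M →
          localSocle R = maximalIdeal R ^ 2 ∧ IsHExceptional h M) ∧
        ({h : ℕ | 1 ≤ h ∧ ExtToRingVanishes h M}.Infinite →
          localSocle R = maximalIdeal R ^ 2 ∧ IsExceptional M)) := by
  refine ⟨fun N _ _ hN ⟨h, hh, hE⟩ => hN.localSocle_eq hm3 hR hh hE, fun M _ _ hM =>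
    ⟨fun hE hMs => ⟨hMs.localSocle_eq hm3 hR le_rfl hE, hE.isHExceptional hm3 hR⟩,
      fun h hh hE => ⟨localSocle_eq_of_extToRingVanishes hm3 hm2 hR hM hh hE,
        hE.isHExceptional hm3 hR⟩, fun hinf => ?_⟩⟩
  -- Infinitely many vanishing degrees are unbounded, and h-exceptionality passes to smaller h.
  have key : ∀ n, ∃ h, n ≤ h ∧ ExtToRingVanishes (h + 1) M := fun n => by
    obtain ⟨h, ⟨-, hE⟩, hn⟩ := hinf.exists_gt n
    obtain ⟨h, rfl⟩ := Nat.exists_eq_add_of_le' (Nat.one_le_of_lt hn)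
    exact ⟨h, Nat.lt_succ_iff.mp hn, hE⟩
  constructor
  · obtain ⟨h, hh, hE⟩ := key 2
    exact localSocle_eq_of_extToRingVanishes hm3 hm2 hR hM hh hE
  · intro n _
    obtain ⟨h, hh, hE⟩ := key n
    exact (hE.isHExceptional hm3 hR).mono hh
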